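/- Let $\mu$ be a (not necessarily symmetric) Borel probability measure on $\mathbb{R}$ with moments $m_k(\mu)=\int x^k\,d\mu(x)$ satisfying $m_1(\mu)=0$, $m_2(\mu)=1$ and $m_4(\mu)<\infty$. For a probability measure $\mu$ on $\mathbb{R}$ put $G_\mu(z)=\int \frac{1}{z-x}\,d\mu(x)$ and $K_\mu(z)=z-1/G_\mu(z)$ for $\operatorname{Im} z>0$; the Boolean convolution $\mu\uplus\nu$ of two probability measures is the unique probability measure on $\mathbb{R}$ with $K_{\mu\uplus\nu}(z)=K_\mu(z)+K_\nu(z)$ whenever $\operatorname{Im} z>0$. For an integer $n\ge 1$ let $\mu^{\uplus n}=\mu\uplus\cdots\uplus\mu$ ($n$ factors), and let $\mu_n$ be the dilation of $\mu^{\uplus n}$ by $1/\sqrt n$, i.e. $\mu_n(A)=\mu^{\uplus n}(\{x: x/\sqrt n\in A\})$. Let $\mathrm{b}=\tfrac12\delta_{-1}+\tfrac12\delta_1$ be the Rademacher distribution and let $W_1(\mu,\nu)=\inf_\pi\iint|x-y|\,d\pi(x,y)$, the infimum being over all couplings $\pi$ of $\mu$ and $\nu$. Then, for every $n\ge1$,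 $$W_1(\mu_n,\mathrm{b})\le \frac{1}{\sqrt n}\sqrt{m_4(\mu)-1}.$$ -/

import Mathlib

open MeasureTheory

noncomputable section

namespace BooleanProb

/-- The Cauchy transform `G_μ(z) = ∫ (z - x)⁻¹ dμ(x)`. -/
def cauchyTransform (μ : Measure ℝ) (z : ℂ) : ℂ :=
  ∫ x : ℝ, (z - (x : ℂ))⁻¹ ∂μ

/-- The self-energy (K-transform) `K_μ(z) = z - 1 / G_μ(z)`. -/
def selfEnergy (μ : Measure ℝ) (z : ℂ) : ℂ :=
  z - (cauchyTransform μ z)⁻¹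

/-- `ρ` is a probability measure whose self-energy is the sum of those of `μ` and `ν` on the open
upper half-plane. -/
def IsBooleanConv (μ ν ρ : Measure ℝ) : Prop :=
  IsProbabilityMeasure ρ ∧
    ∀ z : ℂ, 0 < z.im → selfEnergy ρ z = selfEnergy μ z + selfEnergy ν z

open Classical in
/-- The Boolean convolution `μ ⊎ ν`: the probability measure with
`K_{μ ⊎ ν} = K_μ + K_ν` on the open upper half-plane. If no such probability measure existed, the
value would be the zero measure (which has no coupling with a probability measure). -/
def booleanConv (μ ν : Measure ℝ) : Measure ℝ :=
  if h : ∃ ρ : Measure ℝ, IsBooleanConv μ ν ρ then h.choose else 0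

/-- The Boolean convolution power `μ^{⊎ n}`; the point mass at `0` is neutral for `⊎`. -/
def booleanConvPow (μ : Measure ℝ) : ℕ → Measure ℝ
  | 0 => Measure.dirac 0
  | n + 1 => booleanConv (booleanConvPow μ n) μ

/-- The normalized power `μ_n`: the image of `μ^{⊎ n}` under `x ↦ x / √n`. -/
def normalizedPow (μ : Measure ℝ) (n : ℕ) : Measure ℝ :=
  (booleanConvPow μ n).map (fun x : ℝ => (1 / √(n : ℝ)) * x)

/-- The Rademacher distribution `½ δ_{-1} + ½ δ_1`. -/
def rademacher : Measure ℝ :=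
  (2⁻¹ : ENNReal) • Measure.dirac (-1 : ℝ) + (2⁻¹ : ENNReal) • Measure.dirac (1 : ℝ)

/-- `π` is a coupling of `μ` and `ν`: a measure on `ℝ × ℝ` with marginals `μ` and `ν`. -/
def IsCoupling (μ ν : Measure ℝ) (π : Measure (ℝ × ℝ)) : Prop :=
  π.map Prod.fst = μ ∧ π.map Prod.snd = ν

/-- The Wasserstein-`k` distance, with values in `[0, ∞]`: the infimum over all couplings of
`(∬ |x - y|^k dπ(x, y))^{1/k}`. -/
def wasserstein (k : ℕ) (μ ν : Measure ℝ) : ENNReal :=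
  ⨅ (π : Measure (ℝ × ℝ)) (_ : IsCoupling μ ν π),
    (∫⁻ p : ℝ × ℝ, ENNReal.ofReal (|p.1 - p.2| ^ k) ∂π) ^ (1 / (k : ℝ))

end BooleanProb

end

open Filter Topology

namespace BooleanProb

/-! The bound combines two independent facts. First, every centered `ρ` with finite second moment
satisfies W₁(ρ, b) ≤ ∫ |x² - 1| dρ. The coupling sends the upper half of the mass of `ρ` to 1 and
the lower half to -1. Its cost is at most |x² - 1| plus terms that integrate to zero, because `ρ`
has mean 0 and each half has mass 1/2 (`split_cost_le`, `wasserstein_rademacher_le`). If also m₂(ρ)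
= 1, Cauchy-Schwarz bounds the integral by √(m₄(ρ) - 1).

Second, K is additive, so the expansion of G at infinity gives the moments of the n-th Boolean
power: mean 0, second moment n, fourth moment n m₄ + n(n - 1) (`moments_of_selfEnergy_eq`). After
dilation by 1/√n the excess m₄ - 1 is divided by exactly n, and this is the claimed rate.

The Boolean convolution must also be shown to exist, since otherwise its definition falls back to
the zero measure. For finitely supported measures it is a spectral measure of an explicit Hermitian
matrix (`exists_discrete_conv`). Simple-function approximation and tightness give the general case
(`exists_isBooleanConv`). Uniqueness is never needed: the argument uses only the identity for K. -/

theorem sub_ofReal_ne_zero {z : ℂ} (hz : 0 < z.im) (x : ℝ) : z - (x : ℂ) ≠ 0 := by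
  intro h
  have := congrArg Complex.im h
  simp at this
  exact hz.ne' this

/-! ### Boolean convolution of finitely supported measures: a matrix model -/

/-- The spectral measure of a Hermitian matrix at a unit vector, described by its resolvent. -/
theorem exists_spectral_measure {n : Type*} [Fintype n] [DecidableEq n] {A : Matrix n n ℂ} (hA : A.IsHermitian)
    (v : EuclideanSpace ℂ n) (hv : ‖v‖ = 1) :
    ∃ ρ : Measure ℝ, IsProbabilityMeasure ρ ∧ ∀ (z : ℂ), 0 < z.im →
      ∀ (w : EuclideanSpace ℂ n) (c : ℂ), z • w - Matrix.toEuclideanLin A w = c • v →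
        inner ℂ v w = c * cauchyTransform ρ z := by
  set e := hA.eigenvectorBasis with he
  set l := hA.eigenvalues with hl
  have hsymm := Matrix.isSymmetric_toEuclideanLin_iff.mpr hA
  have hee : ∀ a, Matrix.toEuclideanLin A (e a) = (l a : ℂ) • e a := by
    intro a
    ext i
    have := congrFun (hA.mulVec_eigenvectorBasis a) i
    simpa [Matrix.toLpLin_apply] using this
  refine ⟨∑ a, ENNReal.ofReal (‖inner ℂ (e a) v‖ ^ 2) • Measure.dirac (l a), ⟨?_⟩, ?_⟩
  · simp only [Measure.coe_finsetSum, Measure.coe_smul, Finset.sum_apply, Pi.smul_apply,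
      measure_univ, smul_eq_mul, mul_one]
    rw [← ENNReal.ofReal_sum_of_nonneg (fun _ _ => by positivity), e.sum_sq_norm_inner_right, hv]
    simp
  · intro z hz w c hw
    have hne : ∀ x : ℝ, z - (x : ℂ) ≠ 0 := sub_ofReal_ne_zero hz
    have hG : cauchyTransform
        (∑ a, ENNReal.ofReal (‖inner ℂ (e a) v‖ ^ 2) • Measure.dirac (l a)) z =
        ∑ a, ((‖inner ℂ (e a) v‖ ^ 2 : ℝ) : ℂ) * (z - (l a : ℂ))⁻¹ := by
      rw [cauchyTransform, integral_finsetSum_measure]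
      · refine Finset.sum_congr rfl fun a _ => ?_
        rw [integral_smul_measure, integral_dirac, ENNReal.toReal_ofReal (by positivity)]
        simp
      · intro a _
        exact (integrable_dirac (by simp)).smul_measure (by simp)
    rw [hG, ← e.sum_inner_mul_inner v w, Finset.mul_sum]
    refine Finset.sum_congr rfl fun a _ => ?_
    have h1 : (z - (l a : ℂ)) * inner ℂ (e a) w = c * inner ℂ (e a) v := by
      have := congrArg (fun y => inner ℂ (e a) y) hw
      simp only [inner_sub_right, inner_smul_right] at this
      rw [← hsymm, hee, inner_smul_left, Complex.conj_ofReal] at this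
      rw [sub_mul, this]
    have h2 : inner ℂ (e a) w = c * inner ℂ (e a) v * (z - (l a : ℂ))⁻¹ := by
      rw [← h1]; field_simp [hne]
    have h3 : inner ℂ v (e a) * inner ℂ (e a) v = ((‖inner ℂ (e a) v‖ ^ 2 : ℝ) : ℂ) := by
      rw [← inner_conj_symm v (e a), mul_comm, RCLike.mul_conj]
      push_cast; rfl
    rw [h2, ← h3]; ring

/-- For finitely supported probability measures with masses `p`, `q` at the points `x`, `y`, there
is a probability measure whose reciprocal Cauchy transform is `F₁ + F₂ - z`. -/
theorem exists_discrete_conv {ι κ : Type*} [Fintype ι] [Fintype κ] (p x : ι → ℝ) (q y : κ → ℝ)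
    (hp : ∀ i, 0 ≤ p i) (hq : ∀ k, 0 ≤ q k) (hp1 : ∑ i, p i = 1) (hq1 : ∑ k, q k = 1) :
    ∃ ρ : Measure ℝ, IsProbabilityMeasure ρ ∧ ∀ (z : ℂ), 0 < z.im →
      ∑ i, (p i : ℂ) * (z - x i)⁻¹ ≠ 0 → ∑ k, (q k : ℂ) * (z - y k)⁻¹ ≠ 0 →
      ((∑ i, (p i : ℂ) * (z - x i)⁻¹)⁻¹ + (∑ k, (q k : ℂ) * (z - y k)⁻¹)⁻¹ - z) *
        cauchyTransform ρ z = 1 := by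
  classical
  have hpp : ∀ i, ((√(p i) : ℝ) : ℂ) * (√(p i) : ℝ) = (p i : ℂ) := fun i => by
    rw [← Complex.ofReal_mul, Real.mul_self_sqrt (hp i)]
  have hqq : ∀ i, ((√(q i) : ℝ) : ℂ) * (√(q i) : ℝ) = (q i : ℂ) := fun i => by
    rw [← Complex.ofReal_mul, Real.mul_self_sqrt (hq i)]
  have hp1c : ∑ i, (p i : ℂ) = 1 := by exact_mod_cast hp1
  have hq1c : ∑ i, (q i : ℂ) = 1 := by exact_mod_cast hq1
  -- The model of Boolean independence: diag(x) ⊗ |√q⟩⟨√q| + |√p⟩⟨√p| ⊗ diag(y), with state vector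
  -- √p ⊗ √q.
  let A : Matrix (ι × κ) (ι × κ) ℂ := fun a b =>
    (if a.1 = b.1 then (x a.1 : ℂ) * ((√(q a.2) : ℝ) * (√(q b.2) : ℝ)) else 0) +
    (if a.2 = b.2 then (y a.2 : ℂ) * ((√(p a.1) : ℝ) * (√(p b.1) : ℝ)) else 0)
  have hA : A.IsHermitian := by
    refine Matrix.IsHermitian.ext fun a b => ?_
    simp only [A, star_add, RCLike.star_def]
    congr 1
    · by_cases h : a.1 = b.1
      · simp [h, mul_comm]
      · simp [h, Ne.symm h]
    · by_cases h : a.2 = b.2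
      · simp [h, mul_comm]
      · simp [h, Ne.symm h]
  let v : EuclideanSpace ℂ (ι × κ) :=
    WithLp.toLp 2 fun a => ((√(p a.1) : ℝ) : ℂ) * (√(q a.2) : ℝ)
  have hv : ‖v‖ = 1 := by
    rw [EuclideanSpace.norm_eq, Real.sqrt_eq_one]
    simp only [v, norm_mul, Complex.norm_real, mul_pow, Real.norm_eq_abs, sq_abs]
    simp only [Real.sq_sqrt (hp _), Real.sq_sqrt (hq _), Fintype.sum_prod_type]
    simp [← Finset.mul_sum, hq1, hp1]
  obtain ⟨ρ, hρ, H⟩ := exists_spectral_measure hA v hv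
  refine ⟨ρ, hρ, fun z hz hP hQ => ?_⟩
  have hne : ∀ x : ℝ, z - (x : ℂ) ≠ 0 := sub_ofReal_ne_zero hz
  set P := ∑ i, (p i : ℂ) * (z - x i)⁻¹ with hPd
  set Q := ∑ k, (q k : ℂ) * (z - y k)⁻¹ with hQd
  have hP1 : ∑ i, (p i : ℂ) * (P⁻¹ * (z - x i)⁻¹) = 1 := by
    simp_rw [mul_left_comm _ P⁻¹]
    rw [← Finset.mul_sum, ← hPd, inv_mul_cancel₀ hP]
  have hQ1 : ∑ i, (q i : ℂ) * (Q⁻¹ * (z - y i)⁻¹) = 1 := by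
    simp_rw [mul_left_comm _ Q⁻¹]
    rw [← Finset.mul_sum, ← hQd, inv_mul_cancel₀ hQ]
  -- An unnormalized resolvent vector. Averaging the bracket over `p` leaves only the `Q` term, and
  -- averaging over `q` only the `P` term, so (z - A)w is a multiple of `v`. Its pairing with `v` is
  -- 1 + 1 - 1 = 1.
  let w : EuclideanSpace ℂ (ι × κ) := WithLp.toLp 2 fun a => ((√(p a.1) : ℝ) : ℂ) * (√(q a.2) : ℝ) *
    (P⁻¹ * (z - x a.1)⁻¹ + Q⁻¹ * (z - y a.2)⁻¹ - 1)
  have hw : z • w - Matrix.toEuclideanLin A w = (P⁻¹ + Q⁻¹ - z) • v := by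
    ext ⟨i, k⟩
    have e1 : ∑ j, (p j : ℂ) * (P⁻¹ * (z - x j)⁻¹ + Q⁻¹ * (z - y k)⁻¹ - 1) =
        Q⁻¹ * (z - y k)⁻¹ := by
      simp only [mul_sub, mul_add, Finset.sum_sub_distrib, Finset.sum_add_distrib, hP1,
        ← Finset.sum_mul, hp1c]
      ring
    have e2 : ∑ l, (q l : ℂ) * (P⁻¹ * (z - x i)⁻¹ + Q⁻¹ * (z - y l)⁻¹ - 1) =
        P⁻¹ * (z - x i)⁻¹ := by
      simp only [mul_sub, mul_add, Finset.sum_sub_distrib, Finset.sum_add_distrib, hQ1,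
        ← Finset.sum_mul, hq1c]
      ring
    have e3 : Matrix.mulVec A w.ofLp (i, k) = ((√(p i) : ℝ) : ℂ) * (√(q k) : ℝ) *
        (x i * (P⁻¹ * (z - x i)⁻¹) + y k * (Q⁻¹ * (z - y k)⁻¹)) := by
      rw [← e1, ← e2]
      simp only [Matrix.mulVec, dotProduct, A, w, add_mul, Finset.sum_add_distrib, ite_mul,
        zero_mul, mul_add, Finset.mul_sum]
      congr 1
      · rw [Fintype.sum_prod_type, Finset.sum_comm]
        refine Finset.sum_congr rfl fun l _ => ?_
        simp only [Finset.sum_ite_eq, Finset.mem_univ, if_true]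
        rw [← hqq l]; ring
      · rw [Fintype.sum_prod_type]
        refine Finset.sum_congr rfl fun j _ => ?_
        simp only [Finset.sum_ite_eq, Finset.mem_univ, if_true]
        rw [← hpp j]; ring
    have h1 := hne (x i)
    have h2 := hne (y k)
    have g1 : P⁻¹ = (z - x i) * (P⁻¹ * (z - x i)⁻¹) := by field_simp
    have g2 : Q⁻¹ = (z - y k) * (Q⁻¹ * (z - y k)⁻¹) := by field_simp
    simp only [PiLp.sub_apply, PiLp.smul_apply, Matrix.toLpLin_apply, e3, smul_eq_mul]
    simp only [v, w]
    linear_combination -((√(p i) : ℝ) : ℂ) * (√(q k) : ℝ) * (g1 + g2)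
  rw [← H z hz w _ hw]
  rw [PiLp.inner_apply, Fintype.sum_prod_type]
  have e4 : ∀ i k, inner ℂ (v (i, k)) (w (i, k)) =
      (p i : ℂ) * ((q k : ℂ) * (P⁻¹ * (z - x i)⁻¹ + Q⁻¹ * (z - y k)⁻¹ - 1)) := by
    intro i k
    simp only [v, w, RCLike.inner_apply, map_mul, Complex.conj_ofReal]
    rw [← hpp i, ← hqq k]; ring
  simp only [e4, ← Finset.mul_sum]
  simp only [mul_sub, mul_add, Finset.sum_sub_distrib, Finset.sum_add_distrib, hQ1,
        ← Finset.sum_mul, hq1c, hp1c]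
  simp [hP1]

/-! ### Coupling with the Rademacher distribution -/

theorem exists_median (ρ : Measure ℝ) [IsProbabilityMeasure ρ] :
    ∃ t : ℝ, ρ.real (Set.Iio t) ≤ 1 / 2 ∧ ρ.real (Set.Ioi t) ≤ 1 / 2 := by
  have h0 : ∃ a, ProbabilityTheory.cdf ρ a < 1 / 2 :=
    ((ProbabilityTheory.tendsto_cdf_atBot ρ).eventually_lt_const (by norm_num)).exists
  have h1 : ∃ a, 1 / 2 < ProbabilityTheory.cdf ρ a :=
    ((ProbabilityTheory.tendsto_cdf_atTop ρ).eventually_const_lt (by norm_num)).exists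
  set S := {t | 1 / 2 ≤ ProbabilityTheory.cdf ρ t}
  have hb : BddBelow S := by
    obtain ⟨a, ha⟩ := h0
    refine ⟨a, fun t ht => ?_⟩
    by_contra! h
    exact absurd (ProbabilityTheory.monotone_cdf ρ h.le) (not_le.2 (ha.trans_le ht))
  have hne : S.Nonempty := by
    obtain ⟨a, ha⟩ := h1
    exact ⟨a, ha.le⟩
  -- Below the infimum the cdf is less than 1/2, hence so is every approximation to its left limit;
  -- right continuity makes it at least 1/2 at the infimum itself.
  refine ⟨sInf S, ?_, ?_⟩
  · have hU : Set.Iio (sInf S) = ⋃ n : ℕ, Set.Iic (sInf S - 1 / (n + 1)) := by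
      ext a
      simp only [Set.mem_Iio, Set.mem_iUnion, Set.mem_Iic]
      constructor
      · intro h
        obtain ⟨n, hn⟩ := exists_nat_one_div_lt (sub_pos.2 h)
        exact ⟨n, by linarith⟩
      · rintro ⟨n, hn⟩
        have : (0 : ℝ) < 1 / (n + 1) := by positivity
        linarith
    have hm : Monotone fun n : ℕ => Set.Iic (sInf S - 1 / ((n : ℝ) + 1)) := by
      intro m n hmn
      apply Set.Iic_subset_Iic.2
      gcongr
    have ht := tendsto_measure_iUnion_atTop (μ := ρ) hm
    rw [← hU] at ht
    have ht' := (ENNReal.tendsto_toReal (measure_ne_top ρ _)).comp ht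
    refine le_of_tendsto ht' (Eventually.of_forall fun n => ?_)
    have : sInf S - 1 / ((n : ℝ) + 1) ∉ S := fun h => by
      have := csInf_le hb h
      have : (0 : ℝ) < 1 / (n + 1) := by positivity
      linarith
    have h2 : ProbabilityTheory.cdf ρ (sInf S - 1 / ((n : ℝ) + 1)) < 1 / 2 := not_le.1 this
    rw [ProbabilityTheory.cdf_eq_real] at h2
    exact h2.le
  · have hc : 1 / 2 ≤ ProbabilityTheory.cdf ρ (sInf S) := by
      have hr := (ProbabilityTheory.cdf ρ).right_continuous (sInf S)
      have hr' := (hr.mono Set.Ioi_subset_Ici_self).tendsto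
      refine ge_of_tendsto hr' ?_
      filter_upwards [self_mem_nhdsWithin] with a ha
      obtain ⟨s, hs, hsa⟩ := exists_lt_of_csInf_lt hne ha
      exact le_trans hs (ProbabilityTheory.monotone_cdf ρ hsa.le)
    rw [ProbabilityTheory.cdf_eq_real] at hc
    rw [← Set.compl_Iic, probReal_compl_eq_one_sub measurableSet_Iic]
    linarith

/-- A quantile splitting: a `[0, 1]`-valued threshold function of mean `1/2`. -/
theorem exists_half_split (ρ : Measure ℝ) [IsProbabilityMeasure ρ] :
    ∃ (t θ : ℝ), 0 ≤ θ ∧ θ ≤ 1 ∧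
      ∫ x, (if t < x then 1 else if x = t then θ else 0 : ℝ) ∂ρ = 1 / 2 := by
  obtain ⟨t, h1, h2⟩ := exists_median ρ
  have hs : ρ.real (Set.Iio t) + ρ.real {t} + ρ.real (Set.Ioi t) = 1 := by
    have e1 : ρ.real (Set.Iic t) = ρ.real (Set.Iio t) + ρ.real {t} := by
      rw [← Set.Iio_union_right, measureReal_union (by simp) (measurableSet_singleton t)]
    have := probReal_compl_eq_one_sub (μ := ρ) (measurableSet_Iic (a := t))
    rw [Set.compl_Iic] at this
    linarith
  have hint : ∀ θ : ℝ, ∫ x, (if t < x then 1 else if x = t then θ else 0 : ℝ) ∂ρ =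
      ρ.real (Set.Ioi t) + θ * ρ.real {t} := by
    intro θ
    have : (fun x => (if t < x then 1 else if x = t then θ else 0 : ℝ)) =
        fun x => (Set.Ioi t).indicator (fun _ => (1 : ℝ)) x +
          ({t} : Set ℝ).indicator (fun _ => θ) x := by
      ext x
      rcases lt_trichotomy t x with h | h | h
      · simp [h, h.ne']
      · simp [h]
      · simp [h.ne, not_lt.2 h.le]
    rw [this, integral_add ((integrable_const _).indicator measurableSet_Ioi)
      ((integrable_const _).indicator (measurableSet_singleton t)),
      integral_indicator_const _ measurableSet_Ioi,
      integral_indicator_const _ (measurableSet_singleton t)]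
    simp [mul_comm]
  -- Without an atom at `t` both tails have mass exactly 1/2 and θ is irrelevant; otherwise θ is the
  -- fraction of the atom that completes the upper tail to 1/2.
  rcases eq_or_lt_of_le (measureReal_nonneg (μ := ρ) (s := {t})) with h0 | h0
  · refine ⟨t, 0, le_rfl, zero_le_one, ?_⟩
    rw [hint]; linarith
  · refine ⟨t, (1 / 2 - ρ.real (Set.Ioi t)) / ρ.real {t}, ?_, ?_, ?_⟩
    · apply div_nonneg <;> linarith
    · rw [div_le_one h0]; linarith
    · rw [hint, div_mul_cancel₀ _ h0.ne']; ring

/-- The measure obtained by sending `x` to `1` with probability `g x` and to `-1` otherwise is a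
coupling with the Rademacher distribution. -/
theorem isCoupling_split (ρ : Measure ℝ) [IsProbabilityMeasure ρ] (g : ℝ → ℝ) (hg : Measurable g)
    (hg0 : ∀ x, 0 ≤ g x) (hg1 : ∀ x, g x ≤ 1) (hgi : ∫ x, g x ∂ρ = 1 / 2) :
    IsCoupling ρ rademacher
      ((ρ.withDensity fun x => ENNReal.ofReal (g x)).map (fun x => (x, (1 : ℝ))) +
        (ρ.withDensity fun x => ENNReal.ofReal (1 - g x)).map (fun x => (x, (-1 : ℝ)))) := by
  have hint : Integrable g ρ := by
    refine Integrable.of_bound hg.aestronglyMeasurable 1 (Eventually.of_forall fun x => ?_)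
    rw [Real.norm_eq_abs, abs_of_nonneg (hg0 x)]; exact hg1 x
  have hmg : Measurable fun x => ENNReal.ofReal (g x) := hg.ennreal_ofReal
  have hmg' : Measurable fun x => ENNReal.ofReal (1 - g x) :=
    (measurable_const.sub hg).ennreal_ofReal
  have l1 : ∫⁻ x, ENNReal.ofReal (g x) ∂ρ = 2⁻¹ := by
    rw [← ofReal_integral_eq_lintegral_ofReal hint (Eventually.of_forall hg0), hgi, one_div,
      ENNReal.ofReal_inv_of_pos two_pos]
    simp
  have l2 : ∫⁻ x, ENNReal.ofReal (1 - g x) ∂ρ = 2⁻¹ := by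
    rw [← ofReal_integral_eq_lintegral_ofReal (f := fun x => 1 - g x)
      ((integrable_const _).sub hint)
      (Eventually.of_forall fun x => sub_nonneg.2 (hg1 x)),
      integral_sub (integrable_const _) hint, hgi]
    simp only [integral_const, probReal_univ, smul_eq_mul]
    rw [show (1 : ℝ) * 1 - 1 / 2 = 2⁻¹ by norm_num, ENNReal.ofReal_inv_of_pos two_pos]
    simp
  constructor
  · rw [Measure.map_add _ _ measurable_fst, Measure.map_map measurable_fst (by fun_prop),
      Measure.map_map measurable_fst (by fun_prop)]
    have e1 : (Prod.fst ∘ fun x : ℝ => (x, (1 : ℝ))) = id := rfl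
    have e2 : (Prod.fst ∘ fun x : ℝ => (x, (-1 : ℝ))) = id := rfl
    rw [e1, e2, Measure.map_id, Measure.map_id, ← withDensity_add_left hmg]
    have : ((fun x => ENNReal.ofReal (g x)) + fun x => ENNReal.ofReal (1 - g x)) = 1 := by
      ext x
      simp only [Pi.add_apply, Pi.one_apply]
      rw [← ENNReal.ofReal_add (hg0 x) (sub_nonneg.2 (hg1 x))]
      simp
    rw [this, withDensity_one]
  · rw [Measure.map_add _ _ measurable_snd, Measure.map_map measurable_snd (by fun_prop),
      Measure.map_map measurable_snd (by fun_prop)]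
    have e1 : (Prod.snd ∘ fun x : ℝ => (x, (1 : ℝ))) = fun _ => 1 := rfl
    have e2 : (Prod.snd ∘ fun x : ℝ => (x, (-1 : ℝ))) = fun _ => -1 := rfl
    rw [e1, e2, Measure.map_const, Measure.map_const, withDensity_apply _ MeasurableSet.univ,
      withDensity_apply _ MeasurableSet.univ, Measure.restrict_univ, l1, l2, add_comm, rademacher]

/-- Let u be `t` clamped to [-1, 1]. After division by |x - 1|, the claim needs u ≥ -1 when x > 1
and u ≤ x when -1 ≤ x < 1. For x ≤ -1 the clamp forces u = -1 and the linear term alone equals |x -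
1|. The same u serves in the mirrored inequality for x ≤ t, so its linear terms can cancel after
integration. -/
theorem abs_sub_one_le_of_le {t x : ℝ} (h : t ≤ x) :
    |x - 1| ≤ |x ^ 2 - 1| + max (-1) (min t 1) * (x - 1) := by
  set u := max (-1) (min t 1) with hu
  have hu1 : -1 ≤ u := le_max_left _ _
  have hu2 : u ≤ 1 := max_le (by norm_num) (min_le_right _ _)
  rcases le_total 1 x with h1 | h1
  · rw [abs_of_nonneg (by linarith), abs_of_nonneg (by nlinarith)]
    nlinarith
  rw [abs_of_nonpos (by linarith)]
  rcases le_total (-1) x with h2 | h2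
  · have hux : u ≤ x := max_le h2 ((min_le_left _ _).trans h)
    rw [abs_of_nonpos (by nlinarith)]
    nlinarith
  · have hu3 : u = -1 := max_eq_left ((min_le_left _ _).trans (h.trans h2))
    rw [abs_of_nonneg (by nlinarith), hu3]
    nlinarith

theorem abs_add_one_le_of_le {t x : ℝ} (h : x ≤ t) :
    |x + 1| ≤ |x ^ 2 - 1| + max (-1) (min t 1) * (x + 1) := by
  have h1 := abs_sub_one_le_of_le (neg_le_neg h)
  have h2 : max (-1) (min (-t) 1) = -max (-1) (min t 1) := by
    rcases le_total t 1 with h1 | h1 <;> rcases le_total (-1) t with h2 | h2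
    · rw [min_eq_left h1, max_eq_right h2, min_eq_left (by linarith), max_eq_right (by linarith)]
    · rw [min_eq_left h1, max_eq_left h2, min_eq_right (by linarith)]; norm_num
    · rw [min_eq_right h1, min_eq_left (by linarith), max_eq_left (by linarith)]; norm_num
    · linarith
  rw [h2, neg_sq, show -x - 1 = -(x + 1) by ring, abs_neg] at h1
  linarith

/-- The convex combination of the two one-sided bounds with weights g and 1 - g; the constants -u
and u combine to u(1 - 2g), which has integral zero once g has mean 1/2. At the atom x = t both
bounds apply. -/
theorem split_cost_le (t θ x : ℝ) (hθ0 : 0 ≤ θ) (hθ1 : θ ≤ 1) :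
    (if t < x then 1 else if x = t then θ else 0) * |x - 1| +
      (1 - (if t < x then 1 else if x = t then θ else 0)) * |x + 1| ≤
    |x ^ 2 - 1| + max (-1) (min t 1) * x +
      2 * max (-1) (min t 1) * (1 / 2 - (if t < x then 1 else if x = t then θ else 0)) := by
  rcases lt_trichotomy t x with h | h | h
  · simp only [h, if_true]
    linarith [abs_sub_one_le_of_le h.le]
  · simp only [h, lt_irrefl, if_true, if_false]
    have h1 := mul_le_mul_of_nonneg_left (abs_sub_one_le_of_le (le_refl x)) hθ0
    have h2 := mul_le_mul_of_nonneg_left (abs_add_one_le_of_le (le_refl x)) (sub_nonneg.2 hθ1)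
    linarith
  · simp only [not_lt.2 h.le, h.ne, if_false]
    linarith [abs_add_one_le_of_le h.le]

theorem wasserstein_rademacher_le (ρ : Measure ℝ) [IsProbabilityMeasure ρ]
    (hi : Integrable (fun x : ℝ => x ^ 2) ρ) (h1 : ∫ x, x ∂ρ = 0) :
    wasserstein 1 ρ rademacher ≤ ENNReal.ofReal (∫ x, |x ^ 2 - 1| ∂ρ) := by
  obtain ⟨t, θ, hθ0, hθ1, hg⟩ := exists_half_split ρ
  set g : ℝ → ℝ := fun x => if t < x then 1 else if x = t then θ else 0 with hgd
  have hgm : Measurable g := by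
    refine Measurable.ite measurableSet_Ioi measurable_const ?_
    exact Measurable.ite (measurableSet_singleton t) measurable_const measurable_const
  have hg0 : ∀ x, 0 ≤ g x := fun x => by
    simp only [hgd]; split_ifs <;> linarith
  have hg1 : ∀ x, g x ≤ 1 := fun x => by
    simp only [hgd]; split_ifs <;> linarith
  have hgint : Integrable g ρ := by
    refine Integrable.of_bound hgm.aestronglyMeasurable 1 (Eventually.of_forall fun x => ?_)
    rw [Real.norm_eq_abs, abs_of_nonneg (hg0 x)]; exact hg1 x
  have hix : Integrable (fun x : ℝ => x) ρ := by
    refine (hi.add (integrable_const 1)).mono' (by fun_prop) (Eventually.of_forall fun x => ?_)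
    simp only [Pi.add_apply, Real.norm_eq_abs]
    nlinarith [sq_nonneg (|x| - 1), sq_abs x, abs_nonneg x]
  have ha : Integrable (fun x : ℝ => |x ^ 2 - 1|) ρ := (hi.sub (integrable_const 1)).abs
  refine (iInf₂_le _ (isCoupling_split ρ g hgm hg0 hg1 hg)).trans ?_
  simp only [pow_one, Nat.cast_one, div_one, ENNReal.rpow_one]
  have hgm' : Measurable fun x => ENNReal.ofReal (1 - g x) :=
    (measurable_const.sub hgm).ennreal_ofReal
  have hm : Measurable fun p : ℝ × ℝ => ENNReal.ofReal |p.1 - p.2| := by fun_prop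
  rw [lintegral_add_measure, lintegral_map hm (by fun_prop), lintegral_map hm (by fun_prop),
    lintegral_withDensity_eq_lintegral_mul _ hgm.ennreal_ofReal (by fun_prop),
    lintegral_withDensity_eq_lintegral_mul _ hgm' (by fun_prop), ← lintegral_add_left (by fun_prop)]
  set u := max (-1) (min t 1)
  set b : ℝ → ℝ := fun x => |x ^ 2 - 1| + u * x + 2 * u * (1 / 2 - g x) with hb
  have hle : ∀ x, g x * |x - 1| + (1 - g x) * |x + 1| ≤ b x :=
    fun x => split_cost_le t θ x hθ0 hθ1
  have h0 : ∀ x, 0 ≤ g x * |x - 1| + (1 - g x) * |x + 1| := fun x =>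
    add_nonneg (mul_nonneg (hg0 x) (abs_nonneg _))
      (mul_nonneg (sub_nonneg.2 (hg1 x)) (abs_nonneg _))
  have hbi : Integrable b ρ :=
    (ha.add (hix.const_mul u)).add (((integrable_const _).sub hgint).const_mul _)
  have hbe : ∫ x, b x ∂ρ = ∫ x, |x ^ 2 - 1| ∂ρ := by
    simp only [hb]
    rw [integral_add (f := fun x => |x ^ 2 - 1| + u * x) (g := fun x => 2 * u * (1 / 2 - g x))
        (ha.add (hix.const_mul u)) (((integrable_const _).sub hgint).const_mul _),
      integral_add ha (hix.const_mul u), integral_const_mul, integral_const_mul,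
      integral_sub (integrable_const _) hgint, hg, h1]
    simp
  rw [← hbe, ofReal_integral_eq_lintegral_ofReal hbi
    (Eventually.of_forall fun x => (h0 x).trans (hle x))]
  refine lintegral_mono fun x => ?_
  simp only [Pi.mul_apply]
  rw [← ENNReal.ofReal_mul (hg0 x), ← ENNReal.ofReal_mul (sub_nonneg.2 (hg1 x)),
    ← ENNReal.ofReal_add (mul_nonneg (hg0 x) (abs_nonneg _))
      (mul_nonneg (sub_nonneg.2 (hg1 x)) (abs_nonneg _))]
  apply ENNReal.ofReal_le_ofReal
  have := hle x
  rwa [sub_neg_eq_add]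

/-! ### Existence of the Boolean convolution: Cauchy transforms and tightness -/

theorem norm_inv_sub_ofReal_le {z : ℂ} (hz : 0 < z.im) (x : ℝ) :
    ‖(z - (x : ℂ))⁻¹‖ ≤ z.im⁻¹ := by
  rw [norm_inv]
  gcongr
  have := Complex.abs_im_le_norm (z - (x : ℂ))
  simp only [Complex.sub_im, Complex.ofReal_im, sub_zero] at this
  exact (le_abs_self _).trans this

theorem continuous_inv_sub_ofReal {z : ℂ} (hz : 0 < z.im) :
    Continuous fun x : ℝ => (z - (x : ℂ))⁻¹ :=
  (continuous_const.sub Complex.continuous_ofReal).inv₀ (sub_ofReal_ne_zero hz)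

theorem integrable_inv_sub_ofReal (μ : Measure ℝ) [IsFiniteMeasure μ] {z : ℂ} (hz : 0 < z.im) :
    Integrable (fun x : ℝ => (z - (x : ℂ))⁻¹) μ :=
  Integrable.of_bound (continuous_inv_sub_ofReal hz).aestronglyMeasurable z.im⁻¹
    (Eventually.of_forall (norm_inv_sub_ofReal_le hz))

theorem norm_cauchyTransform_le (μ : Measure ℝ) [IsProbabilityMeasure μ] {z : ℂ} (hz : 0 < z.im) :
    ‖cauchyTransform μ z‖ ≤ z.im⁻¹ := by
  rw [cauchyTransform]
  simpa using norm_integral_le_of_norm_le_const (μ := μ)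
    (Eventually.of_forall (norm_inv_sub_ofReal_le hz))

/-- The imaginary part of 1/(z - x) is strictly negative for every real x, hence so is that of its
average. -/
theorem cauchyTransform_ne_zero (μ : Measure ℝ) [IsProbabilityMeasure μ] {z : ℂ} (hz : 0 < z.im) :
    cauchyTransform μ z ≠ 0 := by
  intro h
  have h1 : 0 < ∫ x : ℝ, -((z - (x : ℂ))⁻¹).im ∂μ := by
    have hpos : ∀ x : ℝ, 0 < -((z - (x : ℂ))⁻¹).im := by
      intro x
      rw [Complex.inv_im]
      have := Complex.normSq_pos.2 (sub_ofReal_ne_zero hz x)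
      simp only [Complex.sub_im, Complex.ofReal_im, sub_zero, neg_div, neg_neg]
      positivity
    rw [integral_pos_iff_support_of_nonneg (fun x => (hpos x).le)
      (integrable_inv_sub_ofReal μ hz).im.neg]
    have : Function.support (fun x : ℝ => -((z - (x : ℂ))⁻¹).im) = Set.univ :=
      Set.eq_univ_of_forall fun x => (hpos x).ne'
    rw [this]; simp
  have h2 : ∫ x : ℝ, ((z - (x : ℂ))⁻¹).im ∂μ = (cauchyTransform μ z).im :=
    integral_im (integrable_inv_sub_ofReal μ hz)
  rw [integral_neg, h2, h] at h1
  simp at h1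

theorem tendsto_cauchyTransform_map (μ : Measure ℝ) [IsProbabilityMeasure μ] (f : ℕ → ℝ → ℝ)
    (hf : ∀ j, Measurable (f j)) (hlim : ∀ x, Tendsto (fun j => f j x) atTop (𝓝 x))
    {z : ℂ} (hz : 0 < z.im) :
    Tendsto (fun j => cauchyTransform (μ.map (f j)) z) atTop (𝓝 (cauchyTransform μ z)) := by
  have hc := continuous_inv_sub_ofReal hz
  have : ∀ j, cauchyTransform (μ.map (f j)) z = ∫ x, (z - (f j x : ℂ))⁻¹ ∂μ := fun j => by
    rw [cauchyTransform, integral_map (hf j).aemeasurable hc.aestronglyMeasurable]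
  simp only [this]
  refine tendsto_integral_of_dominated_convergence (fun _ => z.im⁻¹) (fun j => ?_)
    (integrable_const _) (fun j => Eventually.of_forall fun x => norm_inv_sub_ofReal_le hz _)
    (Eventually.of_forall fun x => ?_)
  · exact (hc.measurable.comp (hf j)).aestronglyMeasurable
  · exact (hc.tendsto x).comp (hlim x)

theorem integral_comp_simpleFunc (μ : Measure ℝ) [IsFiniteMeasure μ] (f : SimpleFunc ℝ ℝ)
    (g : ℝ → ℂ) :
    ∫ x, g (f x) ∂μ = ∑ y : f.range, ((μ.real (f ⁻¹' {(y : ℝ)}) : ℝ) : ℂ) * g y := by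
  have h : ∀ x, g (f x) = ∑ y ∈ f.range, (f ⁻¹' {y}).indicator (fun _ => g y) x := by
    intro x
    rw [Finset.sum_eq_single (f x)]
    · simp
    · intro b _ hb
      simp [Ne.symm hb]
    · intro hx
      exact absurd (f.mem_range_self x) hx
  simp only [h]
  rw [integral_finsetSum _ fun y _ =>
    (integrable_const _).indicator (f.measurableSet_fiber y), ← Finset.sum_coe_sort f.range]
  refine Finset.sum_congr rfl fun y _ => ?_
  rw [integral_indicator_const _ (f.measurableSet_fiber y)]
  simp

theorem exists_simpleFunc_conv (μ ν : Measure ℝ) [IsProbabilityMeasure μ] [IsProbabilityMeasure ν]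
    (f g : SimpleFunc ℝ ℝ) :
    ∃ ρ : Measure ℝ, IsProbabilityMeasure ρ ∧ ∀ (z : ℂ), 0 < z.im →
      ((cauchyTransform (μ.map f) z)⁻¹ + (cauchyTransform (ν.map g) z)⁻¹ - z) *
        cauchyTransform ρ z = 1 := by
  have hsum : ∀ (μ : Measure ℝ) [IsProbabilityMeasure μ] (f : SimpleFunc ℝ ℝ),
      ∑ y : f.range, μ.real (f ⁻¹' {(y : ℝ)}) = 1 := by
    intro μ _ f
    have := integral_comp_simpleFunc μ f (fun _ => 1)
    simp only [integral_const, probReal_univ, one_smul, mul_one] at this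
    exact_mod_cast this.symm
  have hG : ∀ (μ : Measure ℝ) [IsProbabilityMeasure μ] (f : SimpleFunc ℝ ℝ) (z : ℂ), 0 < z.im →
      ∑ y : f.range, ((μ.real (f ⁻¹' {(y : ℝ)}) : ℝ) : ℂ) * (z - ((y : ℝ) : ℂ))⁻¹ =
        cauchyTransform (μ.map f) z := by
    intro μ _ f z hz
    rw [cauchyTransform, integral_map f.measurable.aemeasurable
      (continuous_inv_sub_ofReal hz).aestronglyMeasurable]
    exact (integral_comp_simpleFunc μ f fun y => (z - (y : ℂ))⁻¹).symm
  obtain ⟨ρ, hρ, H⟩ := exists_discrete_conv (fun y : f.range => μ.real (f ⁻¹' {(y : ℝ)}))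
    (fun y => (y : ℝ)) (fun y : g.range => ν.real (g ⁻¹' {(y : ℝ)})) (fun y => (y : ℝ))
    (fun _ => measureReal_nonneg) (fun _ => measureReal_nonneg) (hsum μ f) (hsum ν g)
  refine ⟨ρ, hρ, fun z hz => ?_⟩
  have := H z hz
  rw [hG μ f z hz, hG ν g z hz] at this
  have i1 : IsProbabilityMeasure (μ.map f) :=
    Measure.isProbabilityMeasure_map f.measurable.aemeasurable
  have i2 : IsProbabilityMeasure (ν.map g) :=
    Measure.isProbabilityMeasure_map g.measurable.aemeasurable
  exact this (cauchyTransform_ne_zero _ hz) (cauchyTransform_ne_zero _ hz)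

/-- Expresses a smooth tail functional through values of the Cauchy transform on the imaginary axis.
Its integrand is at least 1/2 for |x| > r, so convergence of transforms controls tails. -/
theorem re_mul_cauchyTransform (ρ : Measure ℝ) [IsProbabilityMeasure ρ] {r : ℝ} (hr : 0 < r) :
    ∫ x, x ^ 2 / (x ^ 2 + r ^ 2) ∂ρ =
      1 - (Complex.I * r * cauchyTransform ρ (Complex.I * r)).re := by
  have hz : 0 < (Complex.I * r).im := by simpa using hr
  have hi : Integrable (fun x : ℝ => Complex.I * r * (Complex.I * r - (x : ℂ))⁻¹) ρ :=
    (integrable_inv_sub_ofReal ρ hz).const_mul _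
  have h1 : ∀ x : ℝ, x ^ 2 / (x ^ 2 + r ^ 2) =
      1 - (Complex.I * r * (Complex.I * r - (x : ℂ))⁻¹).re := by
    intro x
    have : 0 < x ^ 2 + r ^ 2 := by positivity
    simp only [Complex.mul_re, Complex.inv_re, Complex.inv_im, Complex.normSq_apply,
      Complex.sub_re, Complex.sub_im, Complex.I_re, Complex.I_im, Complex.ofReal_re,
      Complex.ofReal_im, Complex.mul_im]
    field_simp
    ring_nf
    field_simp
    ring
  simp only [h1]
  rw [integral_sub (g := fun x : ℝ => (Complex.I * r * (Complex.I * r - (x : ℂ))⁻¹).re)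
    (integrable_const _) hi.re]
  simp only [integral_const, probReal_univ, one_smul, cauchyTransform]
  rw [← integral_const_mul]
  congr 1
  exact integral_re hi

theorem measure_norm_gt_le (ρ : Measure ℝ) [IsProbabilityMeasure ρ] {r : ℝ} (hr : 0 < r) :
    ρ {x | r < ‖x‖} ≤ ENNReal.ofReal
      (2 * (1 - (Complex.I * r * cauchyTransform ρ (Complex.I * r)).re)) := by
  rw [← re_mul_cauchyTransform ρ hr, ← integral_const_mul]
  have hint : Integrable (fun x : ℝ => 2 * (x ^ 2 / (x ^ 2 + r ^ 2))) ρ := by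
    refine Integrable.const_mul (Integrable.of_bound (C := 1)
      (Measurable.aestronglyMeasurable (by fun_prop))
      (Eventually.of_forall fun x => ?_)) 2
    rw [Real.norm_eq_abs, abs_of_nonneg (by positivity)]
    exact div_le_one_of_le₀ (by nlinarith [sq_nonneg r]) (by positivity)
  rw [ofReal_integral_eq_lintegral_ofReal hint (Eventually.of_forall fun x => by positivity)]
  have hm : MeasurableSet {x : ℝ | r < ‖x‖} := measurableSet_lt measurable_const measurable_norm
  rw [← lintegral_indicator_one hm]
  refine lintegral_mono fun x => ?_
  by_cases hx : r < ‖x‖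
  · rw [Set.indicator_of_mem (by exact hx)]
    simp only [Pi.one_apply, ENNReal.one_le_ofReal]
    have : r ^ 2 ≤ x ^ 2 := by
      rw [← sq_abs x]; rw [Real.norm_eq_abs] at hx; gcongr
    have h0 : 0 < x ^ 2 + r ^ 2 := by positivity
    rw [← mul_div_assoc, le_div_iff₀ h0]
    linarith
  · rw [Set.indicator_of_notMem (by exact hx)]
    exact zero_le

theorem tendsto_mul_cauchyTransform (μ : Measure ℝ) [IsProbabilityMeasure μ] :
    Tendsto (fun r : ℝ => Complex.I * r * cauchyTransform μ (Complex.I * r)) atTop (𝓝 1) := by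
  have h : ∀ r : ℝ, Complex.I * r * cauchyTransform μ (Complex.I * r) =
      ∫ x : ℝ, Complex.I * r * (Complex.I * r - (x : ℂ))⁻¹ ∂μ := fun r => by
    rw [integral_const_mul, cauchyTransform]
  simp only [h]
  have h1 : (1 : ℂ) = ∫ _ : ℝ, (1 : ℂ) ∂μ := by simp
  rw [h1]
  refine tendsto_integral_filter_of_dominated_convergence (fun _ => 1) ?_ ?_
    (integrable_const _) (Eventually.of_forall fun x => ?_)
  · exact Eventually.of_forall fun r => by
      apply Measurable.aestronglyMeasurable; fun_prop
  · filter_upwards [eventually_gt_atTop 0] with r hr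
    refine Eventually.of_forall fun x => ?_
    have hz : 0 < (Complex.I * r).im := by simpa using hr
    rw [norm_mul]
    calc _ ≤ r * r⁻¹ := by
          gcongr
          · simp [abs_of_pos hr]
          · simpa using norm_inv_sub_ofReal_le hz x
      _ = 1 := mul_inv_cancel₀ hr.ne'
  · have h2 : Tendsto (fun r : ℝ => (1 + Complex.I * ((r⁻¹ * x : ℝ) : ℂ))⁻¹) atTop
        (𝓝 (1 + Complex.I * ((0 * x : ℝ) : ℂ))⁻¹) := by
      refine Tendsto.inv₀ ?_ (by simp)
      refine tendsto_const_nhds.add (tendsto_const_nhds.mul ?_)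
      exact (Complex.continuous_ofReal.tendsto _).comp (tendsto_inv_atTop_zero.mul_const x)
    simp only [zero_mul, Complex.ofReal_zero, mul_zero, add_zero, inv_one] at h2
    refine h2.congr' ?_
    filter_upwards [eventually_gt_atTop 0] with r hr
    have hr' : (r : ℂ) ≠ 0 := by exact_mod_cast hr.ne'
    have h4 : Complex.I * r - (x : ℂ) = Complex.I * r * (1 + Complex.I * ((r⁻¹ * x : ℝ) : ℂ)) := by
      push_cast
      field_simp
      linear_combination (-(x : ℂ)) * Complex.I_sq
    rw [h4, mul_inv, ← mul_assoc, mul_inv_cancel₀ (mul_ne_zero Complex.I_ne_zero hr'), one_mul]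

/-- A pointwise limit `L` of Cauchy transforms of probability measures is a Cauchy transform of a
probability measure if `z L(z) → 1` along the imaginary axis. -/
theorem exists_cauchyTransform_eq_of_tendsto (ρ : ℕ → Measure ℝ) [∀ j, IsProbabilityMeasure (ρ j)]
    (L : ℂ → ℂ)
    (hL : ∀ z : ℂ, 0 < z.im → Tendsto (fun j => cauchyTransform (ρ j) z) atTop (𝓝 (L z)))
    (hL1 : Tendsto (fun r : ℝ => Complex.I * r * L (Complex.I * r)) atTop (𝓝 1)) :
    ∃ σ : Measure ℝ, IsProbabilityMeasure σ ∧ ∀ z : ℂ, 0 < z.im → cauchyTransform σ z = L z := by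
  -- For fixed r the limsup in j of the mass outside [-r, r] is at most 2(1 - Re(ir L(ir))), which
  -- tends to 0 as r grows.
  have htight : IsTightMeasureSet (Set.range ρ) := by
    apply isTightMeasureSet_range_of_tendsto_limsup_measure_norm_gt
    have hlim : Tendsto (fun r : ℝ => ENNReal.ofReal
        (2 * (1 - (Complex.I * r * L (Complex.I * r)).re))) atTop (𝓝 0) := by
      have h1 := (Complex.continuous_re.tendsto _).comp hL1
      have h2 := ((h1.const_sub 1).const_mul 2)
      have h3 := ENNReal.tendsto_ofReal h2
      simpa using h3
    refine tendsto_of_tendsto_of_tendsto_of_le_of_le' tendsto_const_nhds hlim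
      (Eventually.of_forall fun _ => zero_le) ?_
    filter_upwards [eventually_gt_atTop 0] with r hr
    have hz : 0 < (Complex.I * r).im := by simpa using hr
    have h1 : Tendsto (fun j => ENNReal.ofReal
        (2 * (1 - (Complex.I * r * cauchyTransform (ρ j) (Complex.I * r)).re))) atTop
        (𝓝 (ENNReal.ofReal (2 * (1 - (Complex.I * r * L (Complex.I * r)).re)))) := by
      refine ENNReal.tendsto_ofReal (((Tendsto.const_sub 1 ?_)).const_mul 2)
      exact (Complex.continuous_re.tendsto _).comp ((hL _ hz).const_mul _)
    rw [← h1.limsup_eq]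
    exact limsup_le_limsup (Eventually.of_forall fun j => measure_norm_gt_le (ρ j) hr)
  let P : ℕ → ProbabilityMeasure ℝ := fun j => ⟨ρ j, inferInstance⟩
  have hcomp : IsCompact (closure (Set.range P)) := by
    apply isCompact_closure_of_isTightMeasureSet
    refine htight.subset ?_
    rintro _ ⟨_, ⟨j, rfl⟩, rfl⟩
    exact ⟨j, rfl⟩
  -- Prokhorov compactness along a free ultrafilter replaces the extraction of a subsequence; the
  -- Cauchy transforms already converge to `L`, so any cluster point will do.
  obtain ⟨σ, -, hσ⟩ := isCompact_iff_ultrafilter_le_nhds'.1 hcomp ((hyperfilter ℕ).map P) (by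
    rw [Ultrafilter.mem_map]
    exact Filter.Eventually.of_forall fun j => subset_closure ⟨j, rfl⟩)
  have ht : Tendsto P (hyperfilter ℕ) (𝓝 σ) := hσ
  refine ⟨σ, inferInstance, fun z hz => ?_⟩
  rw [ProbabilityMeasure.tendsto_iff_forall_integral_rclike_tendsto ℂ] at ht
  have h1 := ht (BoundedContinuousFunction.ofNormedAddCommGroup (fun x : ℝ => (z - (x : ℂ))⁻¹)
    (continuous_inv_sub_ofReal hz) z.im⁻¹ (norm_inv_sub_ofReal_le hz))
  exact tendsto_nhds_unique h1 ((hL z hz).mono_left Nat.hyperfilter_le_atTop)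

theorem exists_isBooleanConv (μ ν : Measure ℝ) [IsProbabilityMeasure μ] [IsProbabilityMeasure ν] :
    ∃ ρ, IsBooleanConv μ ν ρ := by
  let f : ℕ → SimpleFunc ℝ ℝ := fun j =>
    SimpleFunc.approxOn (id : ℝ → ℝ) measurable_id Set.univ 0 (Set.mem_univ _) j
  have hf : ∀ x, Tendsto (fun j => f j x) atTop (𝓝 x) := fun x =>
    SimpleFunc.tendsto_approxOn (f := (id : ℝ → ℝ)) measurable_id (Set.mem_univ 0) (by simp)
  choose ρ hρ H using fun j => exists_simpleFunc_conv μ ν (f j) (f j)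
  let D : ℂ → ℂ := fun z => (cauchyTransform μ z)⁻¹ + (cauchyTransform ν z)⁻¹ - z
  have hD : ∀ z : ℂ, 0 < z.im → Tendsto (fun j => (cauchyTransform (ρ j) z)⁻¹) atTop (𝓝 (D z)) := by
    intro z hz
    have h1 := (tendsto_cauchyTransform_map μ (fun j => f j) (fun j => (f j).measurable) hf hz).inv₀
      (cauchyTransform_ne_zero μ hz)
    have h2 := (tendsto_cauchyTransform_map ν (fun j => f j) (fun j => (f j).measurable) hf hz).inv₀
      (cauchyTransform_ne_zero ν hz)
    refine ((h1.add h2).sub_const z).congr fun j => ?_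
    exact eq_inv_of_mul_eq_one_left (H j z hz)
  -- The bound |1/G(z)| ≥ Im z for probability measures survives the limit and keeps `D` away from
  -- zero.
  have hD0 : ∀ z : ℂ, 0 < z.im → D z ≠ 0 := by
    intro z hz h0
    have h1 : z.im ≤ ‖D z‖ := by
      refine ge_of_tendsto (hD z hz).norm (Eventually.of_forall fun j => ?_)
      rw [norm_inv, le_inv_comm₀ hz (norm_pos_iff.2 (cauchyTransform_ne_zero _ hz))]
      exact norm_cauchyTransform_le _ hz
    rw [h0, norm_zero] at h1
    exact absurd h1 (not_le.2 hz)
  obtain ⟨σ, hσ, hσL⟩ := exists_cauchyTransform_eq_of_tendsto ρ (fun z => (D z)⁻¹)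
    (fun z hz => by simpa using (hD z hz).inv₀ (hD0 z hz)) (by
      have h1 := (tendsto_mul_cauchyTransform μ).inv₀ one_ne_zero
      have h2 := (tendsto_mul_cauchyTransform ν).inv₀ one_ne_zero
      have h3 := ((h1.add h2).sub_const 1).inv₀ (by norm_num)
      rw [show ((1 : ℂ)⁻¹ + 1⁻¹ - 1)⁻¹ = 1 by norm_num] at h3
      refine h3.congr' ?_
      filter_upwards [eventually_gt_atTop 0] with r hr
      have hz : 0 < (Complex.I * r).im := by simpa using hr
      have hr' : Complex.I * (r : ℂ) ≠ 0 :=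
        mul_ne_zero Complex.I_ne_zero (by exact_mod_cast hr.ne')
      have : D (Complex.I * r) = Complex.I * r *
          ((Complex.I * r * cauchyTransform μ (Complex.I * r))⁻¹ +
            (Complex.I * r * cauchyTransform ν (Complex.I * r))⁻¹ - 1) := by
        simp only [D, mul_inv (Complex.I * (r : ℂ))]
        rw [mul_sub, mul_add, ← mul_assoc, ← mul_assoc, mul_inv_cancel₀ hr']
        ring
      rw [this, mul_inv (Complex.I * (r : ℂ)) (_ + _ - 1), ← mul_assoc, mul_inv_cancel₀ hr', one_mul])
  refine ⟨σ, hσ, fun z hz => ?_⟩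
  simp only [selfEnergy, hσL z hz, inv_inv, D]
  ring

theorem isBooleanConv_booleanConv (μ ν : Measure ℝ) [IsProbabilityMeasure μ]
    [IsProbabilityMeasure ν] : IsBooleanConv μ ν (booleanConv μ ν) := by
  rw [booleanConv, dif_pos (exists_isBooleanConv μ ν)]
  exact (exists_isBooleanConv μ ν).choose_spec

theorem booleanConvPow_spec (μ : Measure ℝ) [IsProbabilityMeasure μ] (n : ℕ) :
    IsProbabilityMeasure (booleanConvPow μ n) ∧ ∀ z : ℂ, 0 < z.im →
      selfEnergy (booleanConvPow μ n) z = n * selfEnergy μ z := by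
  induction n with
  | zero =>
    refine ⟨by rw [booleanConvPow]; infer_instance, fun z _ => ?_⟩
    simp [booleanConvPow, selfEnergy, cauchyTransform]
  | succ k ih =>
    have := ih.1
    obtain ⟨h1, h2⟩ := isBooleanConv_booleanConv (booleanConvPow μ k) μ
    refine ⟨h1, fun z hz => ?_⟩
    rw [booleanConvPow, h2 z hz, ih.2 z hz]
    push_cast; ring

/-! ### Moments of Boolean powers from the expansion at infinity -/

/-- The function `t ↦ z G_μ(z)` at `z = i / t`. -/
noncomputable def axisTransform (μ : Measure ℝ) (t : ℝ) : ℂ :=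
  ∫ x : ℝ, (1 + Complex.I * ((t * x : ℝ) : ℂ))⁻¹ ∂μ

theorem one_add_I_mul_ne_zero (s : ℝ) : 1 + Complex.I * (s : ℂ) ≠ 0 := by
  intro h
  have := congrArg Complex.re h
  simp at this

theorem norm_inv_one_add_I_mul_le (s : ℝ) : ‖(1 + Complex.I * (s : ℂ))⁻¹‖ ≤ 1 := by
  rw [norm_inv]
  apply inv_le_one_of_one_le₀
  have := Complex.abs_re_le_norm (1 + Complex.I * (s : ℂ))
  simpa using this

theorem axisTransform_eq (μ : Measure ℝ) {t : ℝ} (ht : 0 < t) :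
    axisTransform μ t = Complex.I / t * cauchyTransform μ (Complex.I / t) := by
  rw [axisTransform, cauchyTransform, ← integral_const_mul]
  congr 1
  ext x
  have ht' : (t : ℂ) ≠ 0 := by exact_mod_cast ht.ne'
  have h : Complex.I / t - (x : ℂ) = Complex.I / t * (1 + Complex.I * ((t * x : ℝ) : ℂ)) := by
    push_cast
    field_simp
    linear_combination (-(t : ℂ) * x) * Complex.I_sq
  rw [h, mul_inv, ← mul_assoc, mul_inv_cancel₀ (div_ne_zero Complex.I_ne_zero ht'), one_mul]

theorem im_I_div_pos {t : ℝ} (ht : 0 < t) : 0 < (Complex.I / t).im := by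
  rw [Complex.div_ofReal_im]; simpa using ht

theorem axisTransform_ne_zero (μ : Measure ℝ) [IsProbabilityMeasure μ] {t : ℝ} (ht : 0 < t) :
    axisTransform μ t ≠ 0 := by
  rw [axisTransform_eq μ ht]
  exact mul_ne_zero (div_ne_zero Complex.I_ne_zero (by exact_mod_cast ht.ne'))
    (cauchyTransform_ne_zero μ (im_I_div_pos ht))

/-- From 1/(zG) = 1 - K/z: reciprocals of `axisTransform` turn multiples of K into affine relations.
-/
theorem inv_axisTransform (μ : Measure ℝ) {t : ℝ} (ht : 0 < t) :
    (axisTransform μ t)⁻¹ = 1 - selfEnergy μ (Complex.I / t) / (Complex.I / t) := by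
  have h : Complex.I / (t : ℂ) ≠ 0 :=
    div_ne_zero Complex.I_ne_zero (by exact_mod_cast ht.ne')
  rw [axisTransform_eq μ ht, selfEnergy, mul_inv, sub_div, div_self h]
  ring

theorem measurable_inv_one_add (t : ℝ) :
    Measurable fun x : ℝ => (1 + Complex.I * ((t * x : ℝ) : ℂ))⁻¹ := by fun_prop

theorem integrable_inv_one_add (μ : Measure ℝ) [IsFiniteMeasure μ] (t : ℝ) :
    Integrable (fun x : ℝ => (1 + Complex.I * ((t * x : ℝ) : ℂ))⁻¹) μ :=
  Integrable.of_bound (measurable_inv_one_add t).aestronglyMeasurable 1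
    (Eventually.of_forall fun _ => norm_inv_one_add_I_mul_le _)

theorem integrable_pow_of_le {μ : Measure ℝ} [IsFiniteMeasure μ] {k m : ℕ} (hk : k ≤ m)
    (h : Integrable (fun x : ℝ => x ^ m) μ) : Integrable (fun x : ℝ => x ^ k) μ := by
  refine (h.abs.add (integrable_const 1)).mono' (by fun_prop) (Eventually.of_forall fun x => ?_)
  simp only [Pi.add_apply, Real.norm_eq_abs, abs_pow]
  rcases le_total |x| 1 with h1 | h1
  · have := pow_le_one₀ (n := k) (abs_nonneg x) h1
    have := pow_nonneg (abs_nonneg x) m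
    linarith
  · have := pow_le_pow_right₀ h1 hk
    linarith

/-- The remainder in the fourth order expansion of `axisTransform`. -/
noncomputable def axisRemainder (μ : Measure ℝ) (t : ℝ) : ℂ :=
  ∫ x : ℝ, ((x ^ 4 : ℝ) : ℂ) * (1 + Complex.I * ((t * x : ℝ) : ℂ))⁻¹ ∂μ

/-- The finite geometric expansion of 1/(1 + is) at s = tx, with exact remainder s⁴/(1 + is). -/
theorem axisTransform_expansion (μ : Measure ℝ) [IsProbabilityMeasure μ]
    (hm1 : ∫ x : ℝ, x ∂μ = 0) (hm2 : ∫ x : ℝ, x ^ 2 ∂μ = 1)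
    (hm4 : Integrable (fun x : ℝ => x ^ 4) μ) (t : ℝ) :
    axisTransform μ t = 1 - t ^ 2 + Complex.I * t ^ 3 * ((∫ x, x ^ 3 ∂μ : ℝ) : ℂ) +
      t ^ 4 * axisRemainder μ t := by
  have h1 : Integrable (fun x : ℝ => ((x : ℝ) : ℂ)) μ := by
    simpa using (integrable_pow_of_le (k := 1) (by norm_num) hm4).ofReal (𝕜 := ℂ)
  have h2 : Integrable (fun x : ℝ => ((x ^ 2 : ℝ) : ℂ)) μ :=
    (integrable_pow_of_le (by norm_num) hm4).ofReal
  have h3 : Integrable (fun x : ℝ => ((x ^ 3 : ℝ) : ℂ)) μ :=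
    (integrable_pow_of_le (by norm_num) hm4).ofReal
  have h4 : Integrable
      (fun x : ℝ => ((x ^ 4 : ℝ) : ℂ) * (1 + Complex.I * ((t * x : ℝ) : ℂ))⁻¹) μ :=
    hm4.ofReal.mul_bdd (c := 1) (measurable_inv_one_add t).aestronglyMeasurable
      (Eventually.of_forall fun _ => norm_inv_one_add_I_mul_le _)
  have hpt : ∀ x : ℝ, (1 + Complex.I * ((t * x : ℝ) : ℂ))⁻¹ =
      1 + ((-Complex.I * t) * ((x : ℝ) : ℂ) + ((-(t : ℂ) ^ 2) * ((x ^ 2 : ℝ) : ℂ) +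
        ((Complex.I * t ^ 3) * ((x ^ 3 : ℝ) : ℂ) +
        (t : ℂ) ^ 4 * (((x ^ 4 : ℝ) : ℂ) * (1 + Complex.I * ((t * x : ℝ) : ℂ))⁻¹)))) := by
    intro x
    have hinv := mul_inv_cancel₀ (one_add_I_mul_ne_zero (t * x))
    set w := (1 + Complex.I * ((t * x : ℝ) : ℂ))⁻¹
    push_cast at hinv ⊢
    have key : (1 : ℂ) - (t * x) ^ 4 =
        (1 - Complex.I * (t * x) - (t * x) ^ 2 + Complex.I * (t * x) ^ 3) *
          (1 + Complex.I * (t * x)) := by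
      linear_combination ((t * x : ℂ) ^ 2 - (t * x) ^ 4) * Complex.I_sq
    linear_combination w * key +
      (1 - Complex.I * (t * x) - (t * x) ^ 2 + Complex.I * (t * x) ^ 3) * hinv
  rw [axisTransform]
  rw [integral_congr_ae (Eventually.of_forall hpt)]
  have k1 : Integrable (fun x : ℝ => (-Complex.I * t) * ((x : ℝ) : ℂ)) μ := h1.const_mul _
  have k2 : Integrable (fun x : ℝ => (-(t : ℂ) ^ 2) * ((x ^ 2 : ℝ) : ℂ)) μ := h2.const_mul _
  have k3 : Integrable (fun x : ℝ => (Complex.I * t ^ 3) * ((x ^ 3 : ℝ) : ℂ)) μ := h3.const_mul _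
  have k4 : Integrable (fun x : ℝ => (t : ℂ) ^ 4 *
    (((x ^ 4 : ℝ) : ℂ) * (1 + Complex.I * ((t * x : ℝ) : ℂ))⁻¹)) μ := h4.const_mul _
  have k34 : Integrable (fun x : ℝ => (Complex.I * t ^ 3) * ((x ^ 3 : ℝ) : ℂ) + (t : ℂ) ^ 4 *
    (((x ^ 4 : ℝ) : ℂ) * (1 + Complex.I * ((t * x : ℝ) : ℂ))⁻¹)) μ := k3.add k4
  have k234 : Integrable (fun x : ℝ => (-(t : ℂ) ^ 2) * ((x ^ 2 : ℝ) : ℂ) +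
    ((Complex.I * t ^ 3) * ((x ^ 3 : ℝ) : ℂ) + (t : ℂ) ^ 4 *
    (((x ^ 4 : ℝ) : ℂ) * (1 + Complex.I * ((t * x : ℝ) : ℂ))⁻¹))) μ := k2.add k34
  have k1234 : Integrable (fun x : ℝ => (-Complex.I * t) * ((x : ℝ) : ℂ) +
    ((-(t : ℂ) ^ 2) * ((x ^ 2 : ℝ) : ℂ) + ((Complex.I * t ^ 3) * ((x ^ 3 : ℝ) : ℂ) + (t : ℂ) ^ 4 *
    (((x ^ 4 : ℝ) : ℂ) * (1 + Complex.I * ((t * x : ℝ) : ℂ))⁻¹)))) μ := k1.add k234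
  rw [integral_add (integrable_const _) k1234, integral_add k1 k234,
    integral_add k2 k34, integral_add k3 k4]
  simp only [integral_const_mul, integral_complex_ofReal]
  rw [integral_complex_ofReal (f := fun x : ℝ => x), hm1, hm2, axisRemainder]
  simp
  ring

theorem tendsto_axisRemainder (μ : Measure ℝ) (hm4 : Integrable (fun x : ℝ => x ^ 4) μ) :
    Tendsto (axisRemainder μ) (𝓝[>] 0) (𝓝 ((∫ x, x ^ 4 ∂μ : ℝ) : ℂ)) := by
  rw [← integral_complex_ofReal]
  refine tendsto_integral_filter_of_dominated_convergence (fun x => ‖x ^ 4‖) ?_ ?_ hm4.norm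
    (Eventually.of_forall fun x => ?_)
  · exact Eventually.of_forall fun t => by
      apply Measurable.aestronglyMeasurable; fun_prop
  · refine Eventually.of_forall fun t => Eventually.of_forall fun x => ?_
    rw [norm_mul, Complex.norm_real]
    exact mul_le_of_le_one_right (norm_nonneg _) (norm_inv_one_add_I_mul_le _)
  · have : ContinuousAt (fun t : ℝ => ((x ^ 4 : ℝ) : ℂ) *
        (1 + Complex.I * ((t * x : ℝ) : ℂ))⁻¹) 0 := by
      refine continuousAt_const.mul (ContinuousAt.inv₀ (by fun_prop) ?_)
      exact one_add_I_mul_ne_zero _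
    have h := this.tendsto.mono_left (nhdsWithin_le_nhds (s := Set.Ioi 0))
    simpa using h

theorem integrable_div_one_add (ρ : Measure ℝ) [IsFiniteMeasure ρ] {t : ℝ} (ht : 0 < t) :
    Integrable (fun x : ℝ => x ^ 2 / (1 + t ^ 2 * x ^ 2)) ρ := by
  refine Integrable.of_bound (C := (t ^ 2)⁻¹) (Measurable.aestronglyMeasurable (by fun_prop))
    (Eventually.of_forall fun x => ?_)
  rw [Real.norm_eq_abs, abs_of_nonneg (by positivity), ← one_div,
    div_le_div_iff₀ (by positivity) (by positivity)]
  linarith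

theorem integral_sq_div (ρ : Measure ℝ) [IsProbabilityMeasure ρ] {t : ℝ} (ht : 0 < t) :
    ∫ x, x ^ 2 / (1 + t ^ 2 * x ^ 2) ∂ρ = ((1 - axisTransform ρ t) / (t : ℂ) ^ 2).re := by
  have hi := integrable_inv_one_add ρ t
  have h : ∀ x : ℝ, x ^ 2 / (1 + t ^ 2 * x ^ 2) =
      (1 - (1 + Complex.I * ((t * x : ℝ) : ℂ))⁻¹.re) / t ^ 2 := by
    intro x
    have : 0 < 1 + t ^ 2 * x ^ 2 := by positivity
    simp only [Complex.inv_re, Complex.normSq_apply, Complex.add_re, Complex.add_im,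
      Complex.mul_re, Complex.mul_im, Complex.I_re, Complex.I_im, Complex.ofReal_re,
      Complex.ofReal_im, Complex.one_re, Complex.one_im]
    ring_nf
    field_simp
    ring
  simp only [h]
  rw [integral_div, integral_sub (g := fun x : ℝ => (1 + Complex.I * ((t * x : ℝ) : ℂ))⁻¹.re)
    (integrable_const _) hi.re]
  have h2 : ∫ x : ℝ, (1 + Complex.I * ((t * x : ℝ) : ℂ))⁻¹.re ∂ρ = (axisTransform ρ t).re :=
    integral_re hi
  rw [h2, ← Complex.ofReal_pow, Complex.div_ofReal_re]
  simp

theorem integral_id_div (ρ : Measure ℝ) [IsProbabilityMeasure ρ] {t : ℝ} (ht : 0 < t) :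
    ∫ x, x / (1 + t ^ 2 * x ^ 2) ∂ρ = t * ((1 - axisTransform ρ t) / (t : ℂ) ^ 2).im := by
  have hi := integrable_inv_one_add ρ t
  have h : ∀ x : ℝ, x / (1 + t ^ 2 * x ^ 2) =
      -t⁻¹ * (1 + Complex.I * ((t * x : ℝ) : ℂ))⁻¹.im := by
    intro x
    have : 0 < 1 + t ^ 2 * x ^ 2 := by positivity
    simp only [Complex.inv_im, Complex.normSq_apply, Complex.add_re, Complex.add_im,
      Complex.mul_re, Complex.mul_im, Complex.I_re, Complex.I_im, Complex.ofReal_re,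
      Complex.ofReal_im, Complex.one_re, Complex.one_im]
    ring_nf
    field_simp
  simp only [h]
  have h2 : ∫ x : ℝ, (1 + Complex.I * ((t * x : ℝ) : ℂ))⁻¹.im ∂ρ = (axisTransform ρ t).im :=
    integral_im hi
  rw [integral_const_mul, h2, ← Complex.ofReal_pow, Complex.div_ofReal_im]
  simp only [Complex.sub_im, Complex.one_im]
  field_simp
  ring

theorem tendsto_div_one_add (c x : ℝ) :
    Tendsto (fun t : ℝ => c / (1 + t ^ 2 * x ^ 2)) (𝓝[>] 0) (𝓝 c) := by
  have : ContinuousAt (fun t : ℝ => c / (1 + t ^ 2 * x ^ 2)) 0 :=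
    continuousAt_const.div (by fun_prop) (by simp)
  simpa using this.tendsto.mono_left (nhdsWithin_le_nhds (s := Set.Ioi 0))

theorem tendsto_integral_div_one_add {ρ : Measure ℝ} {f : ℝ → ℝ} (hf : Measurable f)
    (hi : Integrable f ρ) :
    Tendsto (fun t : ℝ => ∫ x, f x / (1 + t ^ 2 * x ^ 2) ∂ρ) (𝓝[>] 0) (𝓝 (∫ x, f x ∂ρ)) := by
  refine tendsto_integral_filter_of_dominated_convergence (fun x => ‖f x‖) ?_ ?_ hi.norm
    (Eventually.of_forall fun x => tendsto_div_one_add _ x)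
  · exact Eventually.of_forall fun t => by
      apply Measurable.aestronglyMeasurable; fun_prop
  · refine Eventually.of_forall fun t => Eventually.of_forall fun x => ?_
    rw [norm_div]
    apply div_le_self (norm_nonneg _)
    rw [Real.norm_eq_abs, abs_of_nonneg (by positivity)]
    nlinarith [mul_nonneg (sq_nonneg t) (sq_nonneg x)]

/-- Fatou's lemma turns the finite limit of truncated integrals into integrability; dominated
convergence then identifies the limit. This is how `ρ` acquires moments that are not assumed. -/
theorem integrable_of_tendsto_integral_div {ρ : Measure ℝ} {f : ℝ → ℝ} {c : ℝ} (hf : Measurable f)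
    (hf0 : ∀ x, 0 ≤ f x) (hi : ∀ t > 0, Integrable (fun x => f x / (1 + t ^ 2 * x ^ 2)) ρ)
    (hc : Tendsto (fun t : ℝ => ∫ x, f x / (1 + t ^ 2 * x ^ 2) ∂ρ) (𝓝[>] 0) (𝓝 c)) :
    Integrable f ρ ∧ ∫ x, f x ∂ρ = c := by
  have hint : Integrable f ρ := by
    refine ⟨hf.aestronglyMeasurable, ?_⟩
    rw [hasFiniteIntegral_iff_ofReal (Eventually.of_forall hf0)]
    have h1 : ∀ x, ENNReal.ofReal (f x) =
        liminf (fun t : ℝ => ENNReal.ofReal (f x / (1 + t ^ 2 * x ^ 2))) (𝓝[>] 0) := fun x =>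
      (ENNReal.tendsto_ofReal (tendsto_div_one_add (f x) x)).liminf_eq.symm
    simp only [h1]
    refine lt_of_le_of_lt (lintegral_liminf_le fun t => by fun_prop) ?_
    have h2 : Tendsto (fun t : ℝ => ∫⁻ x, ENNReal.ofReal (f x / (1 + t ^ 2 * x ^ 2)) ∂ρ) (𝓝[>] 0)
        (𝓝 (ENNReal.ofReal c)) := by
      refine (ENNReal.tendsto_ofReal hc).congr' ?_
      filter_upwards [self_mem_nhdsWithin] with t ht
      exact ofReal_integral_eq_lintegral_ofReal (hi t ht) (Eventually.of_forall fun x =>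
        div_nonneg (hf0 x) (by positivity))
    rw [h2.liminf_eq]
    exact ENNReal.ofReal_lt_top
  exact ⟨hint, tendsto_nhds_unique (tendsto_integral_div_one_add hf hint) hc⟩

theorem moments_of_selfEnergy_eq (μ ρ : Measure ℝ) [IsProbabilityMeasure μ]
    [IsProbabilityMeasure ρ] (hm1 : ∫ x : ℝ, x ∂μ = 0) (hm2 : ∫ x : ℝ, x ^ 2 ∂μ = 1)
    (hm4 : Integrable (fun x : ℝ => x ^ 4) μ) (n : ℕ)
    (hK : ∀ z : ℂ, 0 < z.im → selfEnergy ρ z = n * selfEnergy μ z) :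
    ∫ x, x ∂ρ = 0 ∧ ∫ x, x ^ 2 ∂ρ = n ∧ Integrable (fun x : ℝ => x ^ 4) ρ ∧
      ∫ x, x ^ 4 ∂ρ = n * (∫ x, x ^ 4 ∂μ) + n * (n - 1) := by
  set m3 : ℝ := ∫ x, x ^ 3 ∂μ with hm3
  set m4 : ℝ := ∫ x, x ^ 4 ∂μ with hm4d
  let A := axisRemainder μ
  let e : ℝ → ℂ := fun t => -1 + Complex.I * m3 * t + A t * t ^ 2
  let D : ℝ → ℂ := fun t => 1 - (n - 1) * t ^ 2 * e t
  have hA : Tendsto A (𝓝[>] 0) (𝓝 (m4 : ℂ)) := tendsto_axisRemainder μ hm4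
  have ht0 : Tendsto (fun t : ℝ => (t : ℂ)) (𝓝[>] 0) (𝓝 0) := by
    have := (Complex.continuous_ofReal.tendsto 0).mono_left (nhdsWithin_le_nhds (s := Set.Ioi 0))
    simpa using this
  have he : Tendsto e (𝓝[>] 0) (𝓝 (-1)) := by
    have := (tendsto_const_nhds (x := (-1 : ℂ))).add (ht0.const_mul (Complex.I * m3)) |>.add
      (hA.mul (ht0.pow 2))
    simpa using this
  have hD : Tendsto D (𝓝[>] 0) (𝓝 1) := by
    have := (((ht0.pow 2).const_mul ((n : ℂ) - 1)).mul he).const_sub 1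
    simpa using this
  -- Writing a for `axisTransform`, the hypothesis on K reads 1/a_ρ = 1 - n + n/a_μ, and a_μ = 1 +
  -- t²e; solving for a_ρ produces the denominator `D`.
  have hρ : ∀ t > 0, D t ≠ 0 ∧ (1 - axisTransform ρ t) / (t : ℂ) ^ 2 = -(n * e t / D t) := by
    intro t ht
    have ht' : (t : ℂ) ≠ 0 := by exact_mod_cast ht.ne'
    have hμ0 := axisTransform_ne_zero μ ht
    have hρ0 := axisTransform_ne_zero ρ ht
    have h1 : axisTransform μ t = 1 + t ^ 2 * e t := by
      rw [axisTransform_expansion μ hm1 hm2 hm4]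
      simp only [e, A, ← hm3]; ring
    have h2 : (axisTransform ρ t)⁻¹ = D t / axisTransform μ t := by
      have hμi := inv_axisTransform μ ht
      rw [inv_axisTransform ρ ht, hK _ (im_I_div_pos ht), mul_div_assoc,
        show selfEnergy μ (Complex.I / t) / (Complex.I / t) = 1 - (axisTransform μ t)⁻¹ by
          rw [hμi]; ring]
      field_simp
      simp only [D, h1]; ring
    have hD0 : D t ≠ 0 := by
      intro h
      rw [h, zero_div] at h2
      exact inv_ne_zero hρ0 h2
    refine ⟨hD0, ?_⟩
    have h3 : axisTransform ρ t = axisTransform μ t / D t := by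
      rw [← inv_inv (axisTransform ρ t), h2, inv_div]
    rw [h3, h1]
    field_simp
    simp only [D]; ring
  have hq : Tendsto (fun t : ℝ => (1 - axisTransform ρ t) / (t : ℂ) ^ 2) (𝓝[>] 0) (𝓝 (n : ℂ)) := by
    have h1 := ((he.const_mul (n : ℂ)).div hD one_ne_zero).neg
    simp only [mul_neg, mul_one, div_one, neg_neg] at h1
    refine h1.congr' ?_
    filter_upwards [self_mem_nhdsWithin] with t ht
    exact (hρ t ht).2.symm
  obtain ⟨hi2, hs2⟩ := integrable_of_tendsto_integral_div (ρ := ρ) (f := fun x => x ^ 2) (c := n)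
    (by fun_prop) (fun x => sq_nonneg x) (fun t ht => integrable_div_one_add ρ ht) (by
      refine ((Complex.continuous_re.tendsto _).comp hq).congr' ?_
      filter_upwards [self_mem_nhdsWithin] with t ht
      exact (integral_sq_div ρ ht).symm)
  have hi1 : Integrable (fun x : ℝ => x) ρ := by
    simpa using integrable_pow_of_le (k := 1) (by norm_num) hi2
  have hs1 : ∫ x, x ∂ρ = 0 := by
    refine tendsto_nhds_unique (tendsto_integral_div_one_add measurable_id hi1) ?_
    have h1 : Tendsto (fun t : ℝ => t) (𝓝[>] 0) (𝓝 0) := nhdsWithin_le_nhds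
    have h2 := h1.mul ((Complex.continuous_im.tendsto _).comp hq)
    rw [zero_mul] at h2
    refine h2.congr' ?_
    filter_upwards [self_mem_nhdsWithin] with t ht
    exact (integral_id_div ρ ht).symm
  -- Reduces the truncated fourth moment to the truncated second one, given that the full second
  -- moment is already known to be n.
  have hpt : ∀ t > 0, ∀ x : ℝ, x ^ 4 / (1 + t ^ 2 * x ^ 2) =
      (x ^ 2 - x ^ 2 / (1 + t ^ 2 * x ^ 2)) / t ^ 2 := by
    intro t ht x
    have : 0 < 1 + t ^ 2 * x ^ 2 := by positivity
    field_simp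
    ring
  obtain ⟨hi4, hs4⟩ := integrable_of_tendsto_integral_div (ρ := ρ) (f := fun x => x ^ 4)
    (c := n * m4 + n * (n - 1)) (by fun_prop) (fun x => by positivity)
    (fun t ht => by
      simp only [hpt t ht]
      exact (hi2.sub (integrable_div_one_add ρ ht)).div_const _) (by
    have h1 : Tendsto (fun t : ℝ => (n : ℂ) * (Complex.I * m3 * (n - 1) * t * e t + A t - (n - 1) * e t) /
        D t) (𝓝[>] 0) (𝓝 (n * m4 + n * (n - 1) : ℂ)) := by
      have := ((((ht0.const_mul (Complex.I * m3 * (n - 1))).mul he).add hA).sub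
        (he.const_mul ((n : ℂ) - 1))).const_mul (n : ℂ) |>.div hD one_ne_zero
      rw [show (n * m4 + n * (n - 1) : ℂ) =
        n * (Complex.I * m3 * (n - 1) * 0 * -1 + m4 - (n - 1) * -1) / 1 by ring]
      exact this
    have h2 := (Complex.continuous_re.tendsto _).comp h1
    have h3 : (n * m4 + n * (n - 1) : ℂ).re = n * m4 + n * (n - 1) := by
      have : (n * m4 + n * (n - 1) : ℂ) = ((n * m4 + n * (n - 1) : ℝ) : ℂ) := by push_cast; ring
      rw [this, Complex.ofReal_re]
    rw [h3] at h2
    refine h2.congr' ?_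
    filter_upwards [self_mem_nhdsWithin] with t ht
    have ht : 0 < t := ht
    have ht' : (t : ℂ) ≠ 0 := by exact_mod_cast ht.ne'
    simp only [hpt t ht]
    rw [integral_div, integral_sub hi2 (integrable_div_one_add ρ ht), hs2, integral_sq_div ρ ht,
      (hρ t ht).2]
    have hD0 := (hρ t ht).1
    -- The only term that diverges as t → 0 is i n m₃/t. It is purely imaginary and disappears in
    -- the real part, so the third moment need not vanish.
    have h5 : n * (Complex.I * m3 * (n - 1) * t * e t + A t - (n - 1) * e t) / D t =
        ((n : ℝ) - -(n * e t / D t)) / ((t ^ 2 : ℝ) : ℂ) - Complex.I * ((n * m3 / t : ℝ) : ℂ) := by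
      push_cast
      field_simp
      simp only [D, e]
      ring
    simp only [Function.comp_apply]
    rw [h5, Complex.sub_re, Complex.div_ofReal_re, Complex.sub_re]
    simp)
  exact ⟨hs1, hs2, hi4, hs4⟩

/-! ### Fourth-moment bound and conclusion -/

/-- Nonnegativity of the variance of |x² - 1|, together with ∫ (x² - 1)² = m₄ - 2 + 1. -/
theorem integral_abs_sq_sub_one_le (ρ : Measure ℝ) [IsProbabilityMeasure ρ]
    (h2 : ∫ x, x ^ 2 ∂ρ = 1) (h4 : Integrable (fun x : ℝ => x ^ 4) ρ) :
    ∫ x, |x ^ 2 - 1| ∂ρ ≤ √((∫ x, x ^ 4 ∂ρ) - 1) := by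
  have hi2 : Integrable (fun x : ℝ => x ^ 2) ρ := integrable_pow_of_le (by norm_num) h4
  have ha : Integrable (fun x : ℝ => |x ^ 2 - 1|) ρ := (hi2.sub (integrable_const 1)).abs
  apply Real.le_sqrt_of_sq_le
  set m := ∫ x, |x ^ 2 - 1| ∂ρ with hm
  have hpt : ∀ x : ℝ, (|x ^ 2 - 1| - m) ^ 2 =
      x ^ 4 - (2 * x ^ 2 + (2 * m * |x ^ 2 - 1| - (1 + m ^ 2))) := fun x => by
    have := sq_abs (x ^ 2 - 1)
    linear_combination this
  have h : 0 ≤ ∫ x, (|x ^ 2 - 1| - m) ^ 2 ∂ρ := integral_nonneg fun x => sq_nonneg _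
  simp only [hpt] at h
  have k1 : Integrable (fun x : ℝ => 2 * m * |x ^ 2 - 1| - (1 + m ^ 2)) ρ :=
    (ha.const_mul _).sub (integrable_const _)
  have k2 : Integrable (fun x : ℝ => 2 * x ^ 2 + (2 * m * |x ^ 2 - 1| - (1 + m ^ 2))) ρ :=
    (hi2.const_mul _).add k1
  rw [integral_sub h4 k2, integral_add (hi2.const_mul _) k1,
    integral_sub (ha.const_mul _) (integrable_const _), integral_const_mul, integral_const_mul,
    h2, ← hm] at h
  simp only [integral_const, probReal_univ, smul_eq_mul, one_mul] at h
  nlinarith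

end BooleanProb

open BooleanProb in

theorem mainTheorem10 (μ : Measure ℝ) [IsProbabilityMeasure μ]
    (hm1 : ∫ x : ℝ, x ∂μ = 0)
    (hm2 : ∫ x : ℝ, x ^ 2 ∂μ = 1)
    (hm4 : Integrable (fun x : ℝ => x ^ 4) μ)
    (n : ℕ) (hn : 1 ≤ n) :
    BooleanProb.wasserstein 1 (BooleanProb.normalizedPow μ n) BooleanProb.rademacher ≤
      ENNReal.ofReal (1 / √(n : ℝ) * √((∫ x : ℝ, x ^ 4 ∂μ) - 1)) := by
  obtain ⟨hρ, hK⟩ := booleanConvPow_spec μ n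
  obtain ⟨h1, h2, hi4, h4⟩ := moments_of_selfEnergy_eq μ (booleanConvPow μ n) hm1 hm2 hm4 n hK
  have hn0 : (0 : ℝ) < n := by exact_mod_cast hn
  have hmeas : Measurable fun x : ℝ => 1 / √(n : ℝ) * x := by fun_prop
  have hprob : IsProbabilityMeasure (normalizedPow μ n) :=
    Measure.isProbabilityMeasure_map hmeas.aemeasurable
  have hmap : ∀ k : ℕ, ∫ x, x ^ k ∂(normalizedPow μ n) =
      (1 / √(n : ℝ)) ^ k * ∫ x, x ^ k ∂(booleanConvPow μ n) := fun k => by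
    rw [normalizedPow, integral_map hmeas.aemeasurable (by fun_prop), ← integral_const_mul]
    simp only [mul_pow]
  have hs2 : (1 / √(n : ℝ)) ^ 2 = 1 / n := by
    rw [div_pow, Real.sq_sqrt hn0.le, one_pow]
  have hs4 : (1 / √(n : ℝ)) ^ 4 = (1 / n) ^ 2 := by
    rw [← hs2]; ring
  have e1 : ∫ x, x ∂(normalizedPow μ n) = 0 := by
    simpa [h1] using hmap 1
  have e2 : ∫ x, x ^ 2 ∂(normalizedPow μ n) = 1 := by
    rw [hmap, hs2, h2, one_div_mul_cancel hn0.ne']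
  -- (n m₄ + n(n - 1))/n² - 1 = (m₄ - 1)/n: the source of the rate 1/√n.
  have e4 : ∫ x, x ^ 4 ∂(normalizedPow μ n) - 1 = ((∫ x, x ^ 4 ∂μ) - 1) / n := by
    rw [hmap, hs4, h4]
    field_simp
    ring
  have ei : Integrable (fun x : ℝ => x ^ 4) (normalizedPow μ n) := by
    rw [normalizedPow, integrable_map_measure (by fun_prop) hmeas.aemeasurable]
    simpa only [Function.comp_def, mul_pow] using hi4.const_mul _
  refine (wasserstein_rademacher_le _ (integrable_pow_of_le (by norm_num) ei) e1).trans
    (ENNReal.ofReal_le_ofReal ((integral_abs_sq_sub_one_le _ e2 ei).trans_eq ?_))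
  rw [e4, Real.sqrt_div' _ hn0.le]
  ring
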